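/- Rules. In Fog of War chess the pieces move and capture as in classical chess, and players alternate moves without passing. After each move (of either player) a player observes only the own pieces and the squares to which these can legally move, with any enemy piece on such a square. There is no check, checkmate or stalemate: a king may move to an attacked square, and the game ends exactly when a king is captured, the capturing player winning. There are no draw rules, and castling plays no role. A strategy of White prescribes, as a function of the starting position and of all of White's observations so far, a legal move of White. Theorem. Let White have a king and a rook and Black only a king, on three distinct squares of the $8\times 8$ board, with White to move. Assume that the Black king stands on one of the squares C–F $\times$ 3–6 and is not in check, i.e. not on a square to which the White king or the White rook can legally move. Suppose both players know this starting position. Then White cannot force a win: for every strategy of White there is a strategy of Black, who is told the full position (including White's pieces) at all times, such that in the resulting game White never captures the Black king. -/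

import Mathlib

namespace FogChess

/-- A square of the board as (file, rank): `(0, 0)` is A1, `(7, 0)` is H1, `(0, 7)` is A8. -/
abbrev Square := Fin 8 × Fin 8

/-- A king moves from `s` to `t`: one step horizontally, vertically or diagonally. -/
def KingStep (s t : Square) : Prop :=
  s ≠ t ∧ s.1.val ≤ t.1.val + 1 ∧ t.1.val ≤ s.1.val + 1 ∧
    s.2.val ≤ t.2.val + 1 ∧ t.2.val ≤ s.2.val + 1

/-- `s` and `t` lie on a common file or rank and `u` lies strictly between them. -/
def Between (s u t : Square) : Prop :=
  (s.1 = t.1 ∧ u.1 = s.1 ∧ ((s.2 < u.2 ∧ u.2 < t.2) ∨ (t.2 < u.2 ∧ u.2 < s.2))) ∨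
  (s.2 = t.2 ∧ u.2 = s.2 ∧ ((s.1 < u.1 ∧ u.1 < t.1) ∨ (t.1 < u.1 ∧ u.1 < s.1)))

/-- A rook can travel from `s` to `t` when the other pieces stand on the squares `occ`
(a piece on `t` itself does not block). -/
def RookStep (occ : Set Square) (s t : Square) : Prop :=
  s ≠ t ∧ (s.1 = t.1 ∨ s.2 = t.2) ∧ ∀ u ∈ occ, ¬ Between s u t

/-- White has a king and possibly a rook (`none` once it has been captured),
Black has a lone king. -/
@[ext] structure Position where
  whiteKing : Square
  whiteRook : Option Square
  blackKing : Square

/-- A move of White: the moved piece together with its target square. -/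
inductive WhiteMove where
  | king (target : Square)
  | rook (target : Square)

def WhiteMove.target : WhiteMove → Square
  | .king t => t
  | .rook t => t

/-- The legal moves of White. There is no notion of check: White may move the king to an attacked
square. Moving onto the square of the Black king is legal and captures it. -/
def Position.WhiteLegal (p : Position) : WhiteMove → Prop
  | .king t => KingStep p.whiteKing t ∧ p.whiteRook ≠ some t
  | .rook t => ∃ r, p.whiteRook = some r ∧ RookStep {p.whiteKing, p.blackKing} r t ∧
      t ≠ p.whiteKing

/-- The squares to which the White pieces can legally move. -/
def Position.whiteVisible (p : Position) : Set Square :=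
  {t | ∃ m, p.WhiteLegal m ∧ m.target = t}

/-- The Black king stands on a square to which a White piece can legally move. -/
def Position.BlackInCheck (p : Position) : Prop :=
  p.blackKing ∈ p.whiteVisible

/-- What White observes: the own pieces, the set of squares to which they can legally move, and the
Black king exactly if it stands on one of these squares. -/
structure WhiteView where
  king : Square
  rook : Option Square
  visible : Set Square
  blackKing : Option Square

open Classical in
/-- White's observation in a position. -/
noncomputable def Position.whiteView (p : Position) : WhiteView where
  king := p.whiteKing
  rook := p.whiteRook
  visible := p.whiteVisible
  blackKing := if p.blackKing ∈ p.whiteVisible then some p.blackKing else none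

/-- The position after a move of White (that does not capture the Black king). -/
def Position.afterWhite (p : Position) : WhiteMove → Position
  | .king t => { p with whiteKing := t }
  | .rook t => { p with whiteRook := some t }

/-- The position after the Black king moves to `t`, capturing a rook that stands there. -/
def Position.afterBlack (p : Position) (t : Square) : Position :=
  { p with
    whiteRook := if p.whiteRook = some t then none else p.whiteRook
    blackKing := t }

/-- A strategy of White: the next move depends on all earlier observations (latest first), made
after each move of either player, and on the current observation. It always makes legal moves. -/
structure WhiteStrategy where
  move : List WhiteView → WhiteView → WhiteMove
  legal : ∀ (h : List WhiteView) (p : Position), p.WhiteLegal (move h p.whiteView)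

/-- A strategy of Black, who is told the full positions: the square to which the Black king moves,
depending on all earlier positions (latest first) and on the current position. The Black king may
move to attacked squares; passing is not allowed. -/
structure BlackStrategy where
  move : List Position → Position → Square
  legal : ∀ (h : List Position) (p : Position), KingStep p.blackKing (move h p)

/-- A game ends exactly when a king is captured. -/
inductive Phase where
  | whiteToMove
  | blackToMove
  | whiteWon
  | blackWon

/-- A stage of a game: the phase, all earlier positions (latest first), the current position. -/
structure Game where
  phase : Phase
  past : List Position
  current : Position

/-- White is to move in the position `p`. -/
def Game.start (p : Position) : Game := ⟨.whiteToMove, [], p⟩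

/-- One move of the player whose turn it is; a finished game does not change any more. -/
noncomputable def Game.next (σ : WhiteStrategy) (τ : BlackStrategy) (g : Game) : Game :=
  match g.phase with
  | .whiteToMove =>
      let m := σ.move (g.past.map Position.whiteView) g.current.whiteView
      { phase := if m.target = g.current.blackKing then .whiteWon else .blackToMove
        past := g.current :: g.past
        current := g.current.afterWhite m }
  | .blackToMove =>
      let t := τ.move g.past g.current
      { phase := if t = g.current.whiteKing then .blackWon else .whiteToMove
        past := g.current :: g.past
        current := g.current.afterBlack t }
  | .whiteWon => g
  | .blackWon => g

/-- The game from `p`, White to move, after `n` moves (of both players together). -/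
noncomputable def Game.after (σ : WhiteStrategy) (τ : BlackStrategy) (p : Position) (n : ℕ) : Game :=
  (Game.next σ τ)^[n] (Game.start p)

/-- A king always has two target squares, hence White always has a legal king move. -/
theorem exists_king_move (k : Square) (o : Option Square) : ∃ t, KingStep k t ∧ o ≠ some t := by
  have key : ∀ x : Fin 8, ∃ y : Fin 8, y ≠ x ∧ x.val ≤ y.val + 1 ∧ y.val ≤ x.val + 1 := by decide
  obtain ⟨x, y⟩ := k
  obtain ⟨x', hx, hx1, hx2⟩ := key x
  obtain ⟨y', hy, hy1, hy2⟩ := key y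
  by_cases h : o = some (x', y)
  · refine ⟨(x, y'), ⟨fun e => hy (Prod.ext_iff.1 e).2.symm, ?_, ?_, hy1, hy2⟩, ?_⟩
    · simp
    · simp
    · rw [h]
      intro e
      exact hx (Prod.ext_iff.1 (Option.some.inj e)).1
  · refine ⟨(x', y), ⟨fun e => hx (Prod.ext_iff.1 e).1.symm, hx1, hx2, ?_, ?_⟩, h⟩
    · simp
    · simp

/-- Strategies of White exist. -/
instance : Nonempty WhiteStrategy := by
  choose f hf using exists_king_move
  exact ⟨⟨fun _ v => .king (f v.king v.rook), fun _ p => hf p.whiteKing p.whiteRook⟩⟩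

/-- Strategies of Black exist. -/
instance : Nonempty BlackStrategy := by
  choose f hf using exists_king_move
  exact ⟨⟨fun _ p => f p.blackKing none, fun _ p => (hf p.blackKing none).1⟩⟩

end FogChess

/-! White's strategy `σ` is fixed and deterministic, so Black foresees its moves. While the Black
king is hidden, White's observation does not depend on where it stands: a king that blocked the
rook's view would itself be seen (`Hidden.whiteView`). Black may therefore carry a set `S` of
possible squares, on all of which `σ` plays the same move, and settle the actual square in
hindsight. This is `Escapes`; its one-round recursion is `Escapes.succ`.

A finite collection of sets, the `homes`, is closed under this game: the sixteen central squares as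
singletons, and sixteen triples of neighbouring squares on the ring next to the edge. After any
White move against a hidden home, Black can capture the king, capture an unprotected rook, or get
back to a superset of a home, sometimes only after up to two further rounds. A kernel computation
with bitboards verifies this (`check_eq_true`), and induction on the number of rounds gives
`sound_home`. The starting square is a singleton home, so no hindsight is needed there.

Survival for every finite number of rounds becomes a single strategy by compactness, as Black has
finitely many moves (`exists_blackStrategy`). After an unprotected rook is captured, the bare Black
king can keep away for ever (`survives_of_rook_captured`). -/

namespace FogChess

/-! ### What White observes while the Black king is hidden -/

/-- White, with king on `k` and rook on `r`, can legally move to `t`, when no other piece blocks the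
rook. -/
def Sees (k r t : Square) : Prop :=
  (KingStep k t ∧ r ≠ t) ∨ (RookStep {k} r t ∧ t ≠ k)

/-- A Black king on `b` is not observed by White. -/
def Hidden (k r b : Square) : Prop :=
  b ≠ k ∧ b ≠ r ∧ ¬ Sees k r b

theorem KingStep.symm {s t : Square} (h : KingStep s t) : KingStep t s :=
  ⟨h.1.symm, h.2.2.1, h.2.1, h.2.2.2.2, h.2.2.2.1⟩

theorem not_between_right (s t : Square) : ¬ Between s t t := by
  rintro (⟨-, -, h | h⟩ | ⟨-, -, h | h⟩)
  · exact lt_irrefl _ h.2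
  · exact lt_irrefl _ h.1
  · exact lt_irrefl _ h.2
  · exact lt_irrefl _ h.1

theorem Between.trans {s u v t : Square} (h : Between s u v) (h' : Between s v t) :
    Between s u t := by
  obtain ⟨s1, s2⟩ := s
  obtain ⟨t1, t2⟩ := t
  obtain ⟨u1, u2⟩ := u
  obtain ⟨v1, v2⟩ := v
  simp only [Between] at *
  grind

theorem Between.aligned {s u t : Square} (h : Between s u t) :
    s ≠ u ∧ (s.1 = u.1 ∨ s.2 = u.2) := by
  rcases h with ⟨-, h, h'⟩ | ⟨-, h, h'⟩
  · refine ⟨fun e => ?_, Or.inl h.symm⟩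
    subst e
    rcases h' with h' | h'
    · exact lt_irrefl _ h'.1
    · exact lt_irrefl _ h'.2
  · refine ⟨fun e => ?_, Or.inr h.symm⟩
    subst e
    rcases h' with h' | h'
    · exact lt_irrefl _ h'.1
    · exact lt_irrefl _ h'.2

theorem mem_whiteVisible {k r b t : Square} :
    t ∈ (Position.mk k (some r) b).whiteVisible ↔
      (KingStep k t ∧ r ≠ t) ∨ (RookStep {k, b} r t ∧ t ≠ k) := by
  constructor
  · rintro ⟨m | m, h, rfl⟩
    · exact Or.inl ⟨h.1, fun e => h.2 (congrArg some e)⟩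
    · obtain ⟨r', e, h⟩ := h
      obtain rfl : r = r' := Option.some.inj e
      exact Or.inr h
  · rintro (h | h)
    · exact ⟨.king t, ⟨h.1, fun e => h.2 (Option.some.inj e)⟩, rfl⟩
    · exact ⟨.rook t, ⟨r, rfl, h⟩, rfl⟩

theorem blackKing_mem_whiteVisible {k r b : Square} :
    b ∈ (Position.mk k (some r) b).whiteVisible ↔ Sees k r b := by
  rw [mem_whiteVisible]
  simp [Sees, RookStep, not_between_right]

/-- If the Black king blocked a rook line, the rook would attack it, unless the White king stood in
between; but then the White king would already block that line. So a hidden king leaves no gap in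
the visible squares. -/
theorem Hidden.mem_whiteVisible {k r b t : Square} (h : Hidden k r b) :
    t ∈ (Position.mk k (some r) b).whiteVisible ↔ Sees k r t := by
  rw [FogChess.mem_whiteVisible, Sees]
  refine or_congr Iff.rfl (and_congr_left fun _ => ?_)
  refine and_congr_right fun _ => and_congr_right fun _ => ⟨fun H u hu => H u (Or.inl hu), ?_⟩
  rintro H u (rfl | rfl)
  · exact H _ rfl
  · intro hb
    refine h.2.2 (Or.inr ⟨⟨hb.aligned.1, hb.aligned.2, ?_⟩, h.1⟩)
    rintro v rfl hv
    exact H _ rfl (hv.trans hb)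

/-- What White observes when the Black king is hidden. -/
def hiddenView (k r : Square) : WhiteView where
  king := k
  rook := some r
  visible := {t | Sees k r t}
  blackKing := none

theorem Hidden.whiteView {k r b : Square} (h : Hidden k r b) :
    (Position.mk k (some r) b).whiteView = hiddenView k r := by
  have h1 : (Position.mk k (some r) b).whiteVisible = {t | Sees k r t} :=
    Set.ext fun t => h.mem_whiteVisible
  have h2 : b ∉ (Position.mk k (some r) b).whiteVisible := by
    rw [h1]
    exact h.2.2
  simp only [Position.whiteView, hiddenView, if_neg h2]
  rw [h1]

/-! ### From survival for finitely many rounds to a strategy -/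

/-- White can bring king and rook from `k`, `r` to `k'`, `r'` in one move, when no other piece
blocks the rook. -/
def Reaches (k r k' r' : Square) : Prop :=
  (KingStep k k' ∧ r ≠ k' ∧ r' = r) ∨ (k' = k ∧ RookStep {k} r r' ∧ r' ≠ k)

/-- For `n` rounds Black, who foresees White's moves, can avoid the capture of the Black king. The
list contains White's observations before the position `p`, in which White is to move. -/
def Survives (σ : WhiteStrategy) : ℕ → List WhiteView → Position → Prop
  | 0, _, _ => True
  | n + 1, h, p =>
    let m := σ.move h p.whiteView
    let q := p.afterWhite m
    m.target ≠ p.blackKing ∧ ∃ t, KingStep p.blackKing t ∧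
      (t = q.whiteKing ∨ Survives σ n (q.whiteView :: p.whiteView :: h) (q.afterBlack t))

theorem Survives.of_succ {σ : WhiteStrategy} {n : ℕ} : ∀ {h : List WhiteView} {p : Position},
    Survives σ (n + 1) h p → Survives σ n h p := by
  induction n with
  | zero => exact fun _ => trivial
  | succ n ih =>
    rintro h p ⟨h1, t, ht, h2⟩
    exact ⟨h1, t, ht, h2.imp_right ih⟩

theorem Survives.anti {σ : WhiteStrategy} {h : List WhiteView} {p : Position} {m n : ℕ}
    (hmn : m ≤ n) (H : Survives σ n h p) : Survives σ m h p := by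
  induction hmn with
  | refl => exact H
  | step _ ih => exact ih H.of_succ

/-- Otherwise each `a` fails from some bound on, and the largest of these finitely many bounds
defeats all of them at once. -/
theorem exists_forall_of_anti {α : Type*} [Finite α] {P : α → ℕ → Prop}
    (hP : ∀ a m n, m ≤ n → P a n → P a m) (H : ∀ n, ∃ a, P a n) : ∃ a, ∀ n, P a n := by
  by_contra! hc
  choose f hf using hc
  obtain ⟨N, hN⟩ := (Set.finite_range f).bddAbove
  obtain ⟨a, ha⟩ := H N
  exact hf a (hP a _ _ (hN ⟨a, rfl⟩) ha)

/-- In the position `p`, with Black to move, moving the Black king to `t` is either a capture of the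
White king or leads to a position in which Black survives for ever. -/
def Saves (σ : WhiteStrategy) (h : List WhiteView) (p : Position) (t : Square) : Prop :=
  KingStep p.blackKing t ∧ (t = p.whiteKing ∨
    ∀ n, Survives σ n (p.whiteView :: h) (p.afterBlack t))

theorem exists_saves {σ : WhiteStrategy} {h : List WhiteView} {p : Position}
    (H : ∀ n, Survives σ n h p) :
    (σ.move h p.whiteView).target ≠ p.blackKing ∧
      ∃ t, Saves σ (p.whiteView :: h) (p.afterWhite (σ.move h p.whiteView)) t := by
  refine ⟨(H 1).1, ?_⟩
  have key : ∀ n, ∃ t, KingStep p.blackKing t ∧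
      (t = (p.afterWhite (σ.move h p.whiteView)).whiteKing ∨
        Survives σ n ((p.afterWhite (σ.move h p.whiteView)).whiteView :: p.whiteView :: h)
          ((p.afterWhite (σ.move h p.whiteView)).afterBlack t)) := fun n => (H (n + 1)).2
  obtain ⟨t, ht⟩ := exists_forall_of_anti
    (fun t m n hmn ht => ⟨ht.1, ht.2.imp_right (Survives.anti hmn)⟩) key
  refine ⟨t, ?_, ?_⟩
  · have := (ht 0).1
    cases hm : σ.move h p.whiteView <;> simpa [Position.afterWhite] using this
  · by_cases e : t = (p.afterWhite (σ.move h p.whiteView)).whiteKing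
    · exact Or.inl e
    · exact Or.inr fun n => (ht n).2.resolve_left e

/-- Black plays a saving square whenever one exists and an arbitrary king step otherwise. By
`exists_saves`, the existence of a saving square recurs after each White move. -/
theorem exists_blackStrategy (σ : WhiteStrategy) {p : Position}
    (H : ∀ n, Survives σ n [] p) :
    ∃ τ : BlackStrategy, ∀ n, (Game.after σ τ p n).phase ≠ Phase.whiteWon := by
  classical
  have hex : ∀ (past : List Position) (q : Position), ∃ t, KingStep q.blackKing t ∧
      ((∃ t', Saves σ (past.map Position.whiteView) q t') →
        Saves σ (past.map Position.whiteView) q t) := by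
    intro past q
    by_cases h : ∃ t', Saves σ (past.map Position.whiteView) q t'
    · obtain ⟨t, ht⟩ := h
      exact ⟨t, ht.1, fun _ => ht⟩
    · obtain ⟨t, ht, -⟩ := exists_king_move q.blackKing none
      exact ⟨t, ht, fun h' => absurd h' h⟩
  choose f hf hf' using hex
  refine ⟨⟨f, hf⟩, ?_⟩
  set τ : BlackStrategy := ⟨f, hf⟩ with hτ
  -- The invariant covers every phase except `whiteWon`.
  let Inv : Game → Prop := fun g =>
    (g.phase = .whiteToMove ∧ ∀ n, Survives σ n (g.past.map Position.whiteView) g.current) ∨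
    (g.phase = .blackToMove ∧ ∃ t, Saves σ (g.past.map Position.whiteView) g.current t) ∨
    g.phase = .blackWon
  have step : ∀ g, Inv g → Inv (Game.next σ τ g) := by
    rintro ⟨ph, past, q⟩ (⟨rfl, h⟩ | ⟨rfl, h⟩ | rfl)
    · obtain ⟨h1, h2⟩ := exists_saves h
      refine Or.inr (Or.inl ⟨?_, h2⟩)
      simp [Game.next, h1]
    · have h1 := (hf' past q h).2
      by_cases e : f past q = q.whiteKing
      · exact Or.inr (Or.inr (by simp [Game.next, hτ, e]))
      · exact Or.inl ⟨by simp [Game.next, hτ, e], h1.resolve_left e⟩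
    · exact Or.inr (Or.inr rfl)
  have inv : ∀ n, Inv (Game.after σ τ p n) := by
    intro n
    induction n with
    | zero => exact Or.inl ⟨rfl, H⟩
    | succ n ih =>
      rw [Game.after, Function.iterate_succ_apply']
      exact step _ ih
  intro n
  rcases inv n with h | h | h
  · rw [h.1]; exact nofun
  · rw [h.1]; exact nofun
  · rw [h]; exact nofun

/-! ### Bare kings -/

/-- The kings differ by at least two in one coordinate; a step along the other coordinate preserves
that gap. -/
theorem exists_step_away {k b : Square} (h : ¬ KingStep b k) (hne : k ≠ b) :
    ∃ t, KingStep b t ∧ ¬ KingStep k t := by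
  have key : ∀ y : Fin 8, ∃ z : Fin 8, z ≠ y ∧ y.val ≤ z.val + 1 ∧ z.val ≤ y.val + 1 := by decide
  obtain ⟨b1, b2⟩ := b
  obtain ⟨k1, k2⟩ := k
  obtain ⟨z1, h1, h1', h1''⟩ := key b1
  obtain ⟨z2, h2, h2', h2''⟩ := key b2
  simp only [KingStep, ne_eq, Prod.mk.injEq, Prod.exists] at *
  by_cases hx : b1.val ≤ k1.val + 1 ∧ k1.val ≤ b1.val + 1
  · exact ⟨z1, b2, by grind, by grind⟩
  · exact ⟨b1, z2, by grind, by grind⟩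

theorem survives_of_rook_captured (σ : WhiteStrategy) (n : ℕ) : ∀ (h : List WhiteView)
    {k b : Square}, ¬ KingStep k b → Survives σ n h ⟨k, none, b⟩ := by
  induction n with
  | zero => exact fun _ _ _ _ => trivial
  | succ n ih =>
    intro h k b hkb
    have hl := σ.legal h ⟨k, none, b⟩
    rw [Survives]
    generalize hm : σ.move h (Position.mk k none b).whiteView = m at hl
    cases m with
    | rook t => obtain ⟨r, hr, -⟩ := hl; cases hr
    | king k' =>
      have hne : k' ≠ b := fun e => hkb (e ▸ hl.1)
      refine ⟨hne, ?_⟩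
      by_cases hb : KingStep b k'
      · exact ⟨k', hb, Or.inl rfl⟩
      · obtain ⟨t, ht, ht'⟩ := exists_step_away hb hne
        exact ⟨t, ht, Or.inr (ih _ ht')⟩

/-! ### Sets of possible squares for the Black king -/

/-- Black, hidden on a square of `S`, can choose the actual square such that the Black king escapes
for `n` rounds. -/
def Escapes (σ : WhiteStrategy) (n : ℕ) (k r : Square) (S : Set Square) : Prop :=
  ∀ h, ∃ b ∈ S, Survives σ n h ⟨k, some r, b⟩

theorem Escapes.mono {σ : WhiteStrategy} {n : ℕ} {k r : Square} {S T : Set Square}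
    (hST : S ⊆ T) (h : Escapes σ n k r S) : Escapes σ n k r T := fun l =>
  (h l).imp fun _ hb => ⟨hST hb.1, hb.2⟩

/-- With Black to move and the Black king on a square of `S`, Black can capture a White piece without
being recaptured, or reach one of the families `X k r` of hidden squares. -/
def Responds (X : Square → Square → Set Square → Prop) (k r : Square) (S : Set Square) : Prop :=
  (∃ b ∈ S, KingStep b k) ∨
  (∃ b ∈ S, KingStep b r ∧ ¬ KingStep k r) ∨
  (∃ b ∈ S, X k r {t | KingStep b t ∧ Hidden k r t}) ∨
  X k r {t | ∃ b ∈ S, Hidden k r b ∧ KingStep b t ∧ Hidden k r t}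

theorem Responds.nonempty {σ : WhiteStrategy} {n : ℕ} {k r : Square} {S : Set Square}
    (h : Responds (Escapes σ n) k r S) : S.Nonempty := by
  rcases h with ⟨b, hb, -⟩ | ⟨b, hb, -⟩ | ⟨b, hb, -⟩ | h
  · exact ⟨b, hb⟩
  · exact ⟨b, hb⟩
  · exact ⟨b, hb⟩
  · obtain ⟨-, ⟨b, hb, -⟩, -⟩ := h []
    exact ⟨b, hb⟩

/-- All squares of `S` give White the same view, hence the same move; the actual square is chosen
only after that move is known. -/
theorem Escapes.succ {σ : WhiteStrategy} {n : ℕ} {k r : Square} {S : Set Square}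
    (hS : ∀ b ∈ S, Hidden k r b)
    (H : ∀ k' r', Reaches k r k' r' → Responds (Escapes σ n) k' r' S) :
    Escapes σ (n + 1) k r S := by
  intro h
  -- Legality of White's move is known only in actual positions, so some member of `S` is needed;
  -- any king move of White yields one through `H`.
  have hne : S.Nonempty := by
    obtain ⟨t, ht, ht'⟩ := exists_king_move k (some r)
    exact (H t r (Or.inl ⟨ht, fun e => ht' (congrArg some e), rfl⟩)).nonempty
  obtain ⟨k', r', hr, hmove⟩ : ∃ k' r', Reaches k r k' r' ∧ ∀ b ∈ S,
      (σ.move h (hiddenView k r)).target ≠ b ∧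
      (Position.mk k (some r) b).afterWhite (σ.move h (hiddenView k r)) = ⟨k', some r', b⟩ := by
    obtain ⟨b₀, hb₀⟩ := hne
    -- A legal move onto `b` would make `b` visible.
    have hvis : ∀ b ∈ S, (σ.move h (hiddenView k r)).target ≠ b := by
      rintro b hb rfl
      refine (hS _ hb).2.2 ((hS _ hb).mem_whiteVisible.1 ⟨_, ?_, rfl⟩)
      have := σ.legal h ⟨k, some r, (σ.move h (hiddenView k r)).target⟩
      rwa [(hS _ hb).whiteView] at this
    have hl := σ.legal h ⟨k, some r, b₀⟩
    rw [(hS _ hb₀).whiteView] at hl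
    generalize σ.move h (hiddenView k r) = m at hl hvis ⊢
    cases m with
    | king t =>
      exact ⟨t, r, Or.inl ⟨hl.1, fun e => hl.2 (congrArg some e), rfl⟩,
        fun b hb => ⟨hvis b hb, rfl⟩⟩
    | rook t =>
      obtain ⟨r', e, h1, h2⟩ := hl
      obtain rfl : r = r' := Option.some.inj e
      exact ⟨k, t, Or.inr ⟨rfl, ⟨h1.1, h1.2.1, fun u hu => h1.2.2 u (Or.inl hu)⟩, h2⟩,
        fun b hb => ⟨hvis b hb, rfl⟩⟩
  have key : ∀ b ∈ S, ∀ t, KingStep b t →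
      (t = k' ∨ Survives σ n ((Position.mk k' (some r') b).whiteView :: hiddenView k r :: h)
        ((Position.mk k' (some r') b).afterBlack t)) →
      ∃ b ∈ S, Survives σ (n + 1) h ⟨k, some r, b⟩ := by
    intro b hb t hbt ht
    refine ⟨b, hb, ?_⟩
    rw [Survives, (hS b hb).whiteView, (hmove b hb).2]
    exact ⟨(hmove b hb).1, t, hbt, ht⟩
  have after : ∀ b t, t ≠ r' →
      (Position.mk k' (some r') b).afterBlack t = ⟨k', some r', t⟩ := by
    intro b t ht
    simp [Position.afterBlack, ht.symm]
  have hid : (∃ b ∈ S, Hidden k' r' b ∧ ∃ t, KingStep b t ∧ Hidden k' r' t ∧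
      Survives σ n (hiddenView k' r' :: hiddenView k r :: h) ⟨k', some r', t⟩) →
      ∃ b ∈ S, Survives σ (n + 1) h ⟨k, some r, b⟩ := by
    rintro ⟨b, hb, hb', t, hbt, ht, hs⟩
    refine key b hb t hbt (Or.inr ?_)
    rwa [after b t ht.2.1, hb'.whiteView]
  rcases H k' r' hr with ⟨b, hb, hbk⟩ | ⟨b, hb, hbr, hkr⟩ | ⟨b, hb, hX⟩ | hX
  · exact key b hb k' hbk (Or.inl rfl)
  · refine key b hb r' hbr (Or.inr ?_)
    have : (Position.mk k' (some r') b).afterBlack r' = ⟨k', none, r'⟩ := by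
      simp [Position.afterBlack]
    rw [this]
    exact survives_of_rook_captured σ n _ hkr
  -- White may see `b` after the move, so the history depends on `b`, which must be fixed first.
  · obtain ⟨t, ⟨hbt, ht⟩, hs⟩ := hX ((Position.mk k' (some r') b).whiteView :: hiddenView k r :: h)
    refine key b hb t hbt (Or.inr ?_)
    rwa [after b t ht.2.1]
  -- Here `b` stays hidden, so the history is the same for all candidates and `b` may be chosen
  -- together with `t`.
  · obtain ⟨t, ⟨b, hb, hb', hbt, ht⟩, hs⟩ := hX (hiddenView k' r' :: hiddenView k r :: h)
    exact hid ⟨b, hb, hb', t, hbt, ht, hs⟩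

/-! ### Bitboards and king steps -/

/-- The number of a square: A1 is `0`, A2 is `1`, B1 is `8`. A bitboard is a natural number whose
binary digits stand for the squares with these numbers. -/
def code (q : Square) : ℕ := 8 * q.1.val + q.2.val

theorem code_lt (q : Square) : code q < 64 := by
  unfold code; omega

theorem code_injective : Function.Injective code := by
  rintro ⟨x, y⟩ ⟨x', y'⟩ h
  simp only [code] at h
  ext <;> simp <;> omega

theorem exists_code_eq {i : ℕ} (h : i < 64) : ∃ q, code q = i :=
  ⟨(⟨i / 8, by omega⟩, ⟨i % 8, by omega⟩), by simp only [code]; omega⟩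

/-- The `i`-th binary digit of `s`. -/
def has (s i : ℕ) : Bool := Nat.beq (Nat.land 1 (Nat.shiftRight s i)) 1

theorem has_eq_testBit (s i : ℕ) : has s i = s.testBit i := by
  have h : Nat.land 1 (Nat.shiftRight s i) = 1 &&& (s >>> i) := rfl
  rw [has, h, Nat.testBit, Nat.one_and_eq_mod_two]
  rcases Nat.mod_two_eq_zero_or_one (s >>> i) with h | h <;> rw [h] <;> rfl

/-- The squares of a bitboard. -/
def squares (s : ℕ) : Set Square := {q | s.testBit (code q) = true}

/-- Conjunction, as a bare recursor that the kernel evaluates quickly. -/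
def both (a b : Bool) : Bool := Bool.rec false b a

/-- Disjunction, as a bare recursor that the kernel evaluates quickly. -/
def either (a b : Bool) : Bool := Bool.rec b true a

/-- Choice between two numbers, as a bare recursor that the kernel evaluates quickly. -/
def pick (c : Bool) (a b : ℕ) : ℕ := Bool.rec b a c

/-- The squares of `s` that do not belong to `t`. -/
def remove (s t : ℕ) : ℕ := Nat.xor (Nat.lor s t) t

theorem testBit_remove (s t i : ℕ) :
    (remove s t).testBit i = (s.testBit i && !t.testBit i) := by
  have h : remove s t = (s ||| t) ^^^ t := rfl
  rw [h, Nat.testBit_xor, Nat.testBit_or]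
  cases s.testBit i <;> cases t.testBit i <;> rfl

/-- The bitboard of a single square. -/
def bit (i : ℕ) : ℕ := Nat.shiftLeft 1 i

theorem testBit_bit (i j : ℕ) : (bit i).testBit j = decide (i = j) := by
  have h : bit i = 1 <<< i := rfl
  rw [h, Nat.one_shiftLeft, Nat.testBit_two_pow]

/-- The squares next to a square of `s` on the same file. -/
def beside (s : ℕ) : ℕ :=
  -- The masks delete squares that a shift by one carries over into a neighbouring file.
  Nat.lor (Nat.land (Nat.shiftLeft s 1) 0xfefefefefefefefe)
    (Nat.land (Nat.shiftRight s 1) 0x7f7f7f7f7f7f7f7f)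

/-- The squares next to a square of `s` on the same rank. -/
def stacked (s : ℕ) : ℕ :=
  Nat.lor (Nat.land (Nat.shiftLeft s 8) 0xffffffffffffff00)
    (Nat.land (Nat.shiftRight s 8) 0xffffffffffffff)

/-- The squares a king step away from a square of `s`. -/
def around (s : ℕ) : ℕ := Nat.lor (beside s) (stacked (Nat.lor s (beside s)))

theorem testBit_beside (s : ℕ) (x y : Fin 8) :
    (beside s).testBit (8 * x + y) = true ↔
      (1 ≤ y.val ∧ s.testBit (8 * x + (y - 1)) = true) ∨
      (y.val + 1 < 8 ∧ s.testBit (8 * x + (y + 1)) = true) := by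
  have h : beside s = ((s <<< 1) &&& 0xfefefefefefefefe) ||| ((s >>> 1) &&& 0x7f7f7f7f7f7f7f7f) := rfl
  have h1 : ∀ x y : Fin 8, (0xfefefefefefefefe : ℕ).testBit (8 * x + y) = decide (1 ≤ y.val) := by
    decide +kernel
  have h2 : ∀ x y : Fin 8, (0x7f7f7f7f7f7f7f7f : ℕ).testBit (8 * x + y) = decide (y.val + 1 < 8) := by
    decide +kernel
  rw [h, Nat.testBit_or, Nat.testBit_and, Nat.testBit_and, h1, h2, Nat.testBit_shiftLeft,
    Nat.testBit_shiftRight]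
  rw [show 1 + (8 * x.val + y.val) = 8 * x.val + (y.val + 1) by ring]
  by_cases hy : 1 ≤ y.val
  · rw [show 8 * x.val + y.val - 1 = 8 * x.val + (y.val - 1) by omega]
    simp [hy, show 1 ≤ 8 * x.val + y.val by omega, and_comm]
  · simp [hy, and_comm]

theorem testBit_stacked (s : ℕ) (x y : Fin 8) :
    (stacked s).testBit (8 * x + y) = true ↔
      (1 ≤ x.val ∧ s.testBit (8 * (x - 1) + y) = true) ∨
      (x.val + 1 < 8 ∧ s.testBit (8 * (x + 1) + y) = true) := by
  have h : stacked s = ((s <<< 8) &&& 0xffffffffffffff00) ||| ((s >>> 8) &&& 0xffffffffffffff) := rfl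
  have h1 : ∀ x y : Fin 8, (0xffffffffffffff00 : ℕ).testBit (8 * x + y) = decide (1 ≤ x.val) := by
    decide +kernel
  have h2 : ∀ x y : Fin 8, (0xffffffffffffff : ℕ).testBit (8 * x + y) = decide (x.val + 1 < 8) := by
    decide +kernel
  rw [h, Nat.testBit_or, Nat.testBit_and, Nat.testBit_and, h1, h2, Nat.testBit_shiftLeft,
    Nat.testBit_shiftRight]
  rw [show 8 + (8 * x.val + y.val) = 8 * (x.val + 1) + y.val by ring]
  by_cases hx : 1 ≤ x.val
  · rw [show 8 * x.val + y.val - 8 = 8 * (x.val - 1) + y.val by omega]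
    simp [hx, show 8 ≤ 8 * x.val + y.val by omega, and_comm]
  · simp [hx, and_comm]

theorem mem_squares_beside (s : ℕ) (q : Square) :
    q ∈ squares (beside s) ↔ ∃ p ∈ squares s, p.1 = q.1 ∧
      (p.2.val + 1 = q.2.val ∨ q.2.val + 1 = p.2.val) := by
  obtain ⟨x, y⟩ := q
  refine (testBit_beside s x y).trans ⟨?_, ?_⟩
  · rintro (⟨h, h'⟩ | ⟨h, h'⟩)
    · exact ⟨(x, ⟨y - 1, by omega⟩), h', rfl, Or.inl (Nat.sub_add_cancel h)⟩
    · exact ⟨(x, ⟨y + 1, h⟩), h', rfl, Or.inr rfl⟩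
  · rintro ⟨⟨x, z⟩, hp, rfl, h | h⟩
    · refine Or.inl ⟨by simp only at h; omega, ?_⟩
      rwa [← show z.val = y.val - 1 by simp only at h; omega]
    · refine Or.inr ⟨by simp only at h; omega, ?_⟩
      rwa [show y.val + 1 = z.val from h]

theorem mem_squares_stacked (s : ℕ) (q : Square) :
    q ∈ squares (stacked s) ↔ ∃ p ∈ squares s, p.2 = q.2 ∧
      (p.1.val + 1 = q.1.val ∨ q.1.val + 1 = p.1.val) := by
  obtain ⟨x, y⟩ := q
  refine (testBit_stacked s x y).trans ⟨?_, ?_⟩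
  · rintro (⟨h, h'⟩ | ⟨h, h'⟩)
    · exact ⟨(⟨x - 1, by omega⟩, y), h', rfl, Or.inl (Nat.sub_add_cancel h)⟩
    · exact ⟨(⟨x + 1, h⟩, y), h', rfl, Or.inr rfl⟩
  · rintro ⟨⟨z, y⟩, hp, rfl, h | h⟩
    · refine Or.inl ⟨by simp only at h; omega, ?_⟩
      rwa [← show z.val = x.val - 1 by simp only at h; omega]
    · refine Or.inr ⟨by simp only at h; omega, ?_⟩
      rwa [show x.val + 1 = z.val from h]

theorem mem_squares_lor (s t : ℕ) (q : Square) :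
    q ∈ squares (Nat.lor s t) ↔ q ∈ squares s ∨ q ∈ squares t := by
  simp [squares]

theorem mem_squares_remove (s t : ℕ) (q : Square) :
    q ∈ squares (remove s t) ↔ q ∈ squares s ∧ q ∉ squares t := by
  simp [squares, testBit_remove]

theorem mem_squares_bit (p q : Square) : q ∈ squares (bit (code p)) ↔ q = p := by
  simp [squares, testBit_bit, code_injective.eq_iff, eq_comm]

theorem mem_squares_around (s : ℕ) (q : Square) :
    q ∈ squares (around s) ↔ ∃ p ∈ squares s, KingStep p q := by
  simp only [around, mem_squares_lor, mem_squares_beside, mem_squares_stacked]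
  constructor
  · rintro (⟨p, hp, h1, h2⟩ | ⟨p', hp | ⟨p, hp, h1, h2⟩, h3, h4⟩)
    · refine ⟨p, hp, ?_, ?_⟩
      · rintro rfl; omega
      · omega
    · refine ⟨p', hp, ?_, ?_⟩
      · rintro rfl; omega
      · omega
    · refine ⟨p, hp, ?_, ?_⟩
      · rintro rfl; omega
      · omega
  · rintro ⟨p, hp, hne, h⟩
    by_cases h1 : p.1 = q.1
    · refine Or.inl ⟨p, hp, h1, ?_⟩
      have : p.2.val ≠ q.2.val := fun e => hne (Prod.ext h1 (Fin.ext e))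
      omega
    · have h1' : p.1.val ≠ q.1.val := fun e => h1 (Fin.ext e)
      by_cases h2 : p.2 = q.2
      · exact Or.inr ⟨p, Or.inl hp, h2, by omega⟩
      · have h2' : p.2.val ≠ q.2.val := fun e => h2 (Fin.ext e)
        -- A diagonal step is one along the file followed by one along the rank.
        exact Or.inr ⟨(p.1, q.2), Or.inr ⟨p, hp, rfl, by simp only; omega⟩, rfl, by simp only; omega⟩

theorem mem_squares_around_bit (p q : Square) :
    q ∈ squares (around (bit (code p))) ↔ KingStep p q := by
  simp [mem_squares_around, mem_squares_bit]

theorem testBit_two_pow_sub_two_pow (a b i : ℕ) :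
    (2 ^ a - 2 ^ b).testBit i = decide (b ≤ i ∧ i < a) := by
  by_cases h : b ≤ a
  · have : 2 ^ a - 2 ^ b = (2 ^ (a - b) - 1) <<< b := by
      rw [Nat.shiftLeft_eq, Nat.sub_mul, one_mul, ← pow_add, Nat.sub_add_cancel h]
    rw [this, Nat.testBit_shiftLeft, Nat.testBit_two_pow_sub_one]
    by_cases hi : b ≤ i
    · simp [hi]; omega
    · simp [hi]
  · have : 2 ^ a - 2 ^ b = 0 := Nat.sub_eq_zero_of_le (Nat.pow_le_pow_right (by norm_num) (by omega))
    rw [this, Nat.zero_testBit]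
    symm
    simp; omega

/-! ### Rook moves as bitboards -/

/-- On the file `x`, a rook on rank `y` reaches an interval of ranks, which a king on `(kx, ky)` may
shorten: its first rank. -/
def lower (x y kx ky : ℕ) : ℕ :=
  pick (Nat.beq x kx) (pick (Nat.ble y ky) 0 (Nat.succ ky)) 0

/-- The first rank above the interval that starts at `lower x y kx ky`. -/
def upper (x y kx ky : ℕ) : ℕ :=
  pick (Nat.beq x kx) (pick (Nat.ble ky y) 8 ky) 8

/-- The squares that a rook on `(x, y)` reaches along its file, together with its own square, when
only a king on `(kx, ky)` blocks it. -/
def filePart (x y kx ky : ℕ) : ℕ :=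
  Nat.shiftLeft (Nat.sub (Nat.shiftLeft 1 (upper x y kx ky)) (Nat.shiftLeft 1 (lower x y kx ky)))
    (Nat.mul 8 x)

/-- The squares that a rook on `(x, y)` reaches along its rank, together with its own square, when
only a king on `(kx, ky)` blocks it. -/
def rankPart (x y kx ky : ℕ) : ℕ :=
  Nat.shiftLeft (Nat.land 0x0101010101010101
    (Nat.sub (Nat.shiftLeft 1 (Nat.mul 8 (upper y x ky kx)))
      (Nat.shiftLeft 1 (Nat.mul 8 (lower y x ky kx))))) y

/-- The squares that the rook on `r` can reach, when only the king on `k` blocks it. -/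
def rookMask (k r : ℕ) : ℕ :=
  remove (Nat.lor (filePart (Nat.div r 8) (Nat.mod r 8) (Nat.div k 8) (Nat.mod k 8))
    (rankPart (Nat.div r 8) (Nat.mod r 8) (Nat.div k 8) (Nat.mod k 8))) (bit r)

theorem lower_eq (x y kx ky : ℕ) :
    lower x y kx ky = if x = kx ∧ ky < y then ky + 1 else 0 := by
  have h1 : Nat.beq x kx = decide (x = kx) := by
    rw [Bool.eq_iff_iff, Nat.beq_eq, decide_eq_true_iff]
  have h2 : Nat.ble y ky = decide (y ≤ ky) := by
    rw [Bool.eq_iff_iff, Nat.ble_eq, decide_eq_true_iff]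
  rw [lower, h1, h2]
  by_cases h1 : x = kx <;> by_cases h2 : y ≤ ky <;> simp [h1, h2, pick]

theorem upper_eq (x y kx ky : ℕ) :
    upper x y kx ky = if x = kx ∧ y < ky then ky else 8 := by
  have h1 : Nat.beq x kx = decide (x = kx) := by
    rw [Bool.eq_iff_iff, Nat.beq_eq, decide_eq_true_iff]
  have h2 : Nat.ble ky y = decide (ky ≤ y) := by
    rw [Bool.eq_iff_iff, Nat.ble_eq, decide_eq_true_iff]
  rw [upper, h1, h2]
  by_cases h1 : x = kx <;> by_cases h2 : ky ≤ y <;> simp [h1, h2, pick]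

theorem testBit_filePart {x y kx ky u v : ℕ} (hky : ky < 8) (hv : v < 8) :
    (filePart x y kx ky).testBit (8 * u + v) = true ↔
      u = x ∧ lower x y kx ky ≤ v ∧ v < upper x y kx ky := by
  have h : filePart x y kx ky =
    (1 <<< upper x y kx ky - 1 <<< lower x y kx ky) <<< (8 * x) := rfl
  have h8 : upper x y kx ky ≤ 8 := by
    rw [upper_eq]
    split <;> omega
  rw [h, Nat.one_shiftLeft, Nat.one_shiftLeft, Nat.testBit_shiftLeft, testBit_two_pow_sub_two_pow]
  simp only [ge_iff_le, Bool.and_eq_true, decide_eq_true_eq]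
  omega

theorem testBit_rankPart {x y kx ky u v : ℕ} (hy : y < 8)
    (hu : u < 8) (hv : v < 8) :
    (rankPart x y kx ky).testBit (8 * u + v) = true ↔
      v = y ∧ lower y x ky kx ≤ u ∧ u < upper y x ky kx := by
  have h : rankPart x y kx ky = (0x0101010101010101 &&&
    (1 <<< (8 * upper y x ky kx) - 1 <<< (8 * lower y x ky kx))) <<< y := rfl
  have hc : ∀ i : Fin 64, (0x0101010101010101 : ℕ).testBit i = decide (i.val % 8 = 0) := by
    decide +kernel
  rw [h, Nat.one_shiftLeft, Nat.one_shiftLeft, Nat.testBit_shiftLeft, Nat.testBit_and,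
    testBit_two_pow_sub_two_pow, hc ⟨8 * u + v - y, by omega⟩]
  simp only [ge_iff_le, Bool.and_eq_true, decide_eq_true_eq]
  omega

/-- On each line through the rook the reachable squares form an interval ending just short of the
king, which excludes the king's own square. -/
theorem mem_squares_rookMask (k r q : Square) (hkr : k ≠ r) :
    q ∈ squares (rookMask (code k) (code r)) ↔ RookStep {k} r q ∧ q ≠ k := by
  have hdiv : ∀ q : Square, Nat.div (code q) 8 = q.1.val := fun q =>
    show code q / 8 = _ by unfold code; omega
  have hmod : ∀ q : Square, Nat.mod (code q) 8 = q.2.val := fun q =>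
    show code q % 8 = _ by unfold code; omega
  rw [rookMask, mem_squares_remove, mem_squares_lor, mem_squares_bit, hdiv, hdiv, hmod, hmod]
  obtain ⟨x, y⟩ := r
  obtain ⟨u, v⟩ := q
  obtain ⟨kx, ky⟩ := k
  rw [squares, squares, Set.mem_ofPred_eq, Set.mem_ofPred_eq, code,
    testBit_filePart ky.2 v.2, testBit_rankPart y.2 u.2 v.2, lower_eq, lower_eq, upper_eq, upper_eq]
  simp only [RookStep, Between, ne_eq, Prod.mk.injEq, Fin.ext_iff, Fin.lt_def,
    Set.mem_singleton_iff, forall_eq] at *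
  have := kx.2
  have := ky.2
  have := x.2
  have := y.2
  have := u.2
  have := v.2
  split_ifs <;> omega

/-! ### Bounded quantifiers for kernel evaluation -/

/-- Evaluates `n` before it is handed to `f`. -/
def force (n : ℕ) (f : ℕ → Bool) : Bool := Nat.rec (f 0) (fun m _ => f (Nat.succ m)) n

theorem force_eq (n : ℕ) (f : ℕ → Bool) : force n f = f n := by cases n <;> rfl

theorem both_eq (a b : Bool) : both a b = (a && b) := by cases a <;> rfl

theorem either_eq (a b : Bool) : either a b = (a || b) := by cases a <;> rfl

/-- `p` holds for all members of `l`. -/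
def allIn (p : ℕ → Bool) (l : List ℕ) : Bool := List.rec true (fun a _ ih => both (p a) ih) l

theorem allIn_eq (p : ℕ → Bool) (l : List ℕ) : allIn p l = l.all p := by
  induction l with
  | nil => rfl
  | cons a l ih => rw [List.all_cons, ← ih, ← both_eq]; rfl

/-- `p` holds for some member of `l`. -/
def anyIn (p : ℕ → Bool) (l : List ℕ) : Bool := List.rec false (fun a _ ih => either (p a) ih) l

theorem anyIn_eq (p : ℕ → Bool) (l : List ℕ) : anyIn p l = l.any p := by
  induction l with
  | nil => rfl
  | cons a l ih => rw [List.any_cons, ← ih, ← either_eq]; rfl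

/-- `p` holds for all numbers below `n`. -/
def allBelow (n : ℕ) (p : ℕ → Bool) : Bool := Nat.rec true (fun i ih => both (p i) ih) n

theorem of_allBelow {n : ℕ} {p : ℕ → Bool} (h : allBelow n p = true) : ∀ i < n, p i = true := by
  induction n with
  | zero => exact fun i hi => absurd hi (Nat.not_lt_zero i)
  | succ n ih =>
    have h' : both (p n) (allBelow n p) = true := h
    rw [both_eq, Bool.and_eq_true] at h'
    intro i hi
    rcases Nat.lt_succ_iff_lt_or_eq.1 hi with hi | rfl
    · exact ih h'.2 i hi
    · exact h'.1

/-- `p` holds for all bits of `s`, of which there are at most `n`. -/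
def allBits (p : ℕ → Bool) (n : ℕ) : ℕ → Bool :=
  Nat.rec (fun s => Nat.beq s 0)
    (fun _ ih s => either (Nat.beq s 0) (both (p (Nat.log2 s))
      (force (remove s (bit (Nat.log2 s))) ih))) n

/-- No bound on `s` is needed: when the fuel `n` runs out, the test accepts only the empty bitboard.
-/
theorem of_allBits {p : ℕ → Bool} {n : ℕ} : ∀ {s : ℕ}, allBits p n s = true →
    ∀ i, s.testBit i = true → p i = true := by
  induction n with
  | zero =>
    intro s h i hi
    obtain rfl : s = 0 := Nat.eq_of_beq_eq_true h
    simp at hi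
  | succ n ih =>
    intro s h i hi
    have h' : either (Nat.beq s 0) (both (p (Nat.log2 s))
      (force (remove s (bit (Nat.log2 s))) (allBits p n))) = true := h
    rw [either_eq, both_eq, force_eq, Bool.or_eq_true, Bool.and_eq_true, Nat.beq_eq] at h'
    rcases h' with rfl | ⟨h1, h2⟩
    · simp at hi
    · by_cases e : Nat.log2 s = i
      · rwa [← e]
      · exact ih h2 i (by simp [testBit_remove, testBit_bit, hi, e])

/-- `p` holds for one of the `n` leading bits of `s`. -/
def anyBits (p : ℕ → Bool) (n : ℕ) : ℕ → Bool :=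
  Nat.rec (fun _ => false)
    (fun _ ih s => either (both (has s (Nat.log2 s)) (p (Nat.log2 s)))
      (Bool.rec (force (remove s (bit (Nat.log2 s))) ih) false (Nat.beq s 0))) n

theorem of_anyBits {p : ℕ → Bool} {n : ℕ} : ∀ {s : ℕ}, anyBits p n s = true →
    ∃ i, s.testBit i = true ∧ p i = true := by
  induction n with
  | zero => exact fun h => absurd h Bool.false_ne_true
  | succ n ih =>
    intro s h
    have h' : either (both (has s (Nat.log2 s)) (p (Nat.log2 s)))
      (Bool.rec (force (remove s (bit (Nat.log2 s))) (anyBits p n)) false (Nat.beq s 0)) = true := h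
    -- The `has` test certifies the leading bit, also for `s = 0`, where `Nat.log2` returns the
    -- default `0`.
    rw [either_eq, both_eq, force_eq, Bool.or_eq_true, Bool.and_eq_true, has_eq_testBit] at h'
    rcases h' with h' | h'
    · exact ⟨_, h'⟩
    · cases e : Nat.beq s 0 <;> rw [e] at h'
      · obtain ⟨i, hi, hp⟩ := ih h'
        rw [testBit_remove, Bool.and_eq_true] at hi
        exact ⟨i, hi.1, hp⟩
      · exact absurd h' Bool.false_ne_true

/-! ### Hidden squares, captures and White's moves as bitboards -/

/-- The common squares of two bitboards. -/
def common (s t : ℕ) : ℕ := Nat.land (Nat.land s t) 0xffffffffffffffff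

theorem testBit_common (s t i : ℕ) :
    (common s t).testBit i = true ↔ i < 64 ∧ s.testBit i = true ∧ t.testBit i = true := by
  have h : common s t = (s &&& t) &&& (2 ^ 64 - 1) := rfl
  rw [h, Nat.testBit_and, Nat.testBit_and, Nat.testBit_two_pow_sub_one]
  simp only [Bool.and_eq_true, decide_eq_true_eq]
  tauto

/-- The bitboards have no square in common. -/
def disjoint (s t : ℕ) : Bool := Nat.beq (common s t) 0

theorem disjoint_eq_true (s t : ℕ) :
    disjoint s t = true ↔ ∀ q ∈ squares s, q ∉ squares t := by
  rw [disjoint, Nat.beq_eq]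
  constructor
  · intro h q hs ht
    have := (testBit_common s t (code q)).2 ⟨code_lt q, hs, ht⟩
    rw [h] at this
    simp at this
  · intro h
    refine Nat.eq_of_testBit_eq fun i => ?_
    rw [Nat.zero_testBit, Bool.eq_false_iff]
    intro hi
    obtain ⟨h1, h2, h3⟩ := (testBit_common s t i).1 hi
    obtain ⟨q, rfl⟩ := exists_code_eq h1
    exact h q h2 h3

theorem disjoint_eq_false (s t : ℕ) :
    disjoint s t = false ↔ ∃ q ∈ squares s, q ∈ squares t := by
  rw [← Bool.not_eq_true, disjoint_eq_true]
  push Not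
  rfl

/-- The bitboards have a square in common. -/
def meets (s t : ℕ) : Bool := Bool.rec true false (disjoint s t)

theorem meets_eq_true (s t : ℕ) :
    meets s t = true ↔ ∃ q ∈ squares s, q ∈ squares t := by
  rw [← disjoint_eq_false, meets]
  cases disjoint s t <;> simp

/-- The squares that are not hidden from White. -/
def guarded (k r : ℕ) : ℕ :=
  Nat.lor (Nat.lor (bit k) (around (bit k))) (Nat.lor (bit r) (rookMask k r))

theorem not_mem_squares_guarded {k r : Square} (hkr : k ≠ r) (q : Square) :
    q ∉ squares (guarded (code k) (code r)) ↔ Hidden k r q := by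
  simp only [guarded, mem_squares_lor, mem_squares_bit, mem_squares_around_bit,
    mem_squares_rookMask k r q hkr, Hidden, Sees]
  grind

/-- The squares from which the Black king can capture without being recaptured. -/
def prizes (k r : ℕ) : ℕ :=
  Nat.lor (around (bit k)) (pick (has (around (bit k)) r) 0 (around (bit r)))

theorem mem_squares_prizes (k r q : Square) : q ∈ squares (prizes (code k) (code r)) ↔
    KingStep q k ∨ (KingStep q r ∧ ¬ KingStep k r) := by
  have h : has (around (bit (code k))) (code r) = true ↔ KingStep k r := by
    rw [has_eq_testBit]
    exact mem_squares_around_bit k r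
  rw [prizes, mem_squares_lor, mem_squares_around_bit]
  refine or_congr ⟨KingStep.symm, KingStep.symm⟩ ?_
  cases e : has (around (bit (code k))) (code r)
  · rw [← h, e]
    refine (mem_squares_around_bit r q).trans ⟨fun h => ⟨h.symm, by simp⟩, fun h => h.1.symm⟩
  · rw [← h, e]
    simp [pick, squares]

/-- Every move of White leads to a position satisfying `p`. -/
def allMoves (p : ℕ → ℕ → Bool) (k r : ℕ) : Bool :=
  both (force (remove (around (bit k)) (bit r)) (allBits (fun t => p t r) 64))
    (force (rookMask k r) (allBits (p k) 64))

theorem of_allMoves {p : ℕ → ℕ → Bool} {k r k' r' : Square} (hkr : k ≠ r)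
    (h : allMoves p (code k) (code r) = true) (hm : Reaches k r k' r') :
    p (code k') (code r') = true := by
  rw [allMoves, both_eq, force_eq, force_eq, Bool.and_eq_true] at h
  rcases hm with ⟨h1, h2, rfl⟩ | ⟨rfl, h1, h2⟩
  · refine of_allBits h.1 _ ((mem_squares_remove _ _ k').2 ⟨(mem_squares_around_bit _ _).2 h1, ?_⟩)
    rw [mem_squares_bit]
    exact h2.symm
  · exact of_allBits h.2 _ ((mem_squares_rookMask _ _ r' hkr).2 ⟨h1, h2⟩)

theorem Reaches.ne {k r k' r' : Square} (h : Reaches k r k' r') : k' ≠ r' := by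
  rcases h with ⟨-, h, rfl⟩ | ⟨rfl, -, h⟩
  · exact h.symm
  · exact h.symm

theorem Between.symm {s u t : Square} (h : Between s u t) : Between t u s := by
  obtain ⟨s1, s2⟩ := s
  obtain ⟨t1, t2⟩ := t
  obtain ⟨u1, u2⟩ := u
  simp only [Between] at *
  grind

/-- Lets `answers` enumerate the positions before White's move with `allMoves`. -/
theorem Reaches.symm {k r k' r' : Square} (hkr : k ≠ r) (h : Reaches k r k' r') :
    Reaches k' r' k r := by
  rcases h with ⟨h, -, rfl⟩ | ⟨rfl, h, -⟩
  · exact Or.inl ⟨h.symm, hkr.symm, rfl⟩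
  · exact Or.inr ⟨rfl, ⟨h.1.symm, h.2.1.imp Eq.symm Eq.symm, fun u hu hb => h.2.2 u hu hb.symm⟩,
      hkr.symm⟩

/-! ### Black's responses and lookahead -/

/-- Black can respond to a move of White by a capture or by reaching a bitboard satisfying `e`. -/
def respond (e : ℕ → Bool) (k r s : ℕ) : Bool :=
  either (meets s (prizes k r))
    (force (guarded k r) fun v =>
      either (anyBits (fun b => force (remove (around (bit b)) v) e) 64 (common s v))
        (force (remove (around (remove s v)) v) e))

/-- Black escapes for `n` rounds from every bitboard of hidden squares that satisfies `e`. -/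
def Sound (σ : WhiteStrategy) (n : ℕ) (k r : Square) (e : ℕ → Bool) : Prop :=
  ∀ s, e s = true → (∀ q ∈ squares s, Hidden k r q) → Escapes σ n k r (squares s)

theorem Sound.responds {σ : WhiteStrategy} {n : ℕ} {k r : Square} {e : ℕ → Bool}
    (he : Sound σ n k r e) (hkr : k ≠ r) {s : ℕ}
    (h : respond e (code k) (code r) s = true) : Responds (Escapes σ n) k r (squares s) := by
  have hg := not_mem_squares_guarded hkr
  rw [respond, force_eq, either_eq, either_eq, force_eq, Bool.or_eq_true, Bool.or_eq_true] at h
  rcases h with h | h | h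
  · obtain ⟨q, hq, hq'⟩ := (meets_eq_true _ _).1 h
    rcases (mem_squares_prizes k r q).1 hq' with h | h
    · exact Or.inl ⟨q, hq, h⟩
    · exact Or.inr (Or.inl ⟨q, hq, h⟩)
  · obtain ⟨i, hi, h⟩ := of_anyBits h
    obtain ⟨h1, h2, -⟩ := (testBit_common _ _ _).1 hi
    obtain ⟨q, rfl⟩ := exists_code_eq h1
    rw [force_eq] at h
    refine Or.inr (Or.inr (Or.inl ⟨q, h2, Escapes.mono ?_ (he _ h ?_)⟩))
    · intro t ht
      rwa [mem_squares_remove, mem_squares_around_bit, hg] at ht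
    · intro t ht
      rw [mem_squares_remove, hg] at ht
      exact ht.2
  · refine Or.inr (Or.inr (Or.inr (Escapes.mono ?_ (he _ h ?_))))
    · intro t ht
      rw [mem_squares_remove, mem_squares_around, hg] at ht
      obtain ⟨⟨q, hq, hqt⟩, ht⟩ := ht
      rw [mem_squares_remove, hg] at hq
      exact ⟨q, hq.1, hq.2, hqt, ht⟩
    · intro t ht
      rw [mem_squares_remove, hg] at ht
      exact ht.2

/-- A bitboard of hidden squares, with White to move, satisfies `e` or Black can respond to every
move of White by reaching a bitboard that satisfies `f`. -/
def expand (e : ℕ → Bool) (f : ℕ → ℕ → ℕ → Bool) (k r s : ℕ) : Bool :=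
  either (e s) (allMoves (fun k' r' => respond (f k' r') k' r' s) k r)

/-- The extra round gives survival for `n + 1` rounds, which is weakened to `n`; lookahead thus fits
into the induction without changing `n`. -/
theorem Sound.expand {σ : WhiteStrategy} {n : ℕ} {k r : Square} {e : ℕ → Bool}
    {f : ℕ → ℕ → ℕ → Bool} (he : Sound σ n k r e) (hkr : k ≠ r)
    (hf : ∀ k' r', k' ≠ r' → Sound σ n k' r' (f (code k') (code r'))) :
    Sound σ n k r (expand e f (code k) (code r)) := by
  intro s h hs
  rw [FogChess.expand, either_eq, Bool.or_eq_true] at h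
  rcases h with h | h
  · exact he s h hs
  · intro l
    obtain ⟨b, hb, hb'⟩ := Escapes.succ hs
      (fun k' r' hr => (hf k' r' hr.ne).responds hr.ne (of_allMoves hkr h hr)) l
    exact ⟨b, hb, hb'.of_succ⟩

/-! ### The homes and the finite check -/

/-- The squares C3 to F6. -/
def centre : ℕ := 0x3c3c3c3c0000

/-- The numbers of the central squares. -/
def centreSquares : List ℕ :=
  [18, 19, 20, 21, 26, 27, 28, 29, 34, 35, 36, 37, 42, 43, 44, 45]

/-- Three neighbouring squares on a line next to the edge of the board. -/
def triples : List ℕ :=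
  [1, 2, 3, 4].flatMap fun i => [1, 6].flatMap fun j =>
    [Nat.shiftLeft 0x10101 (8 * i + j), Nat.shiftLeft 7 (8 * j + i)]

/-- The families of squares on which Black, when hidden, escapes for ever. -/
def homes : List ℕ := triples ++ centreSquares.map bit

/-- The bitboard contains one of the homes. -/
def home (s : ℕ) : Bool :=
  either (meets s centre)
    (anyIn (fun h => Nat.beq (Nat.land h s) h) triples)

theorem exists_mem_homes {s : ℕ} (h : home s = true) :
    ∃ t ∈ homes, squares t ⊆ squares s := by
  rw [home, either_eq, anyIn_eq, Bool.or_eq_true] at h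
  rcases h with h | h
  · obtain ⟨q, hs, hq⟩ := (meets_eq_true _ _).1 h
    have key : ∀ i : Fin 64, centre.testBit i = true → i.val ∈ centreSquares := by decide +kernel
    refine ⟨bit (code q), List.mem_append_right _ (List.mem_map_of_mem
      (key ⟨code q, code_lt q⟩ hq)), fun p hp => ?_⟩
    rwa [(mem_squares_bit q p).1 hp]
  · obtain ⟨t, ht, hts⟩ := List.any_eq_true.1 h
    rw [Nat.beq_eq] at hts
    refine ⟨t, List.mem_append_left _ ht, fun p hp => ?_⟩
    have hts' : t &&& s = t := hts
    have hp' : t.testBit (code p) = true := hp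
    rw [← hts', Nat.testBit_and, Bool.and_eq_true] at hp'
    exact hp'.2

/-- Black, hidden on `h`, can respond to every move of White after which king and rook stand on `k`
and `r`. -/
def answers (k r h : ℕ) : Bool :=
  either (respond home k r h)
    (allMoves (fun k' r' => either (meets h (guarded k' r'))
      (respond (expand home (expand home fun _ _ => home) k r) k r h)) k r)

/-- The squares from which the Black king can capture or reach a hidden central square. -/
def outlets (k r : ℕ) : ℕ :=
  Nat.lor (prizes k r) (around (remove centre (guarded k r)))

/-- Black, hidden on a home, can respond to every move of White after which the White king stands
on `k`. -/
def check (k : ℕ) : Bool :=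
  allBelow 64 fun r => either (Nat.beq k r) (force (outlets k r) fun g =>
    allIn (fun h => either (meets h g) (answers k r h)) homes)

/-- The computational core: all placements of king and rook after a White move, against all 32
homes. -/
theorem check_eq_true : allBelow 64 check = true := by decide +kernel

theorem homes_nonempty : ∀ t ∈ homes, (squares t).Nonempty := by
  have key : homes.all (meets 0xffffffffffffffff) = true := by decide +kernel
  intro t ht
  obtain ⟨q, -, hq⟩ := (meets_eq_true _ _).1 (List.all_eq_true.1 key t ht)
  exact ⟨q, hq⟩

/-- The check is indexed by the position after White's move. It tries a capture or a hidden central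
square, then any home, and only then uses the position before the move together with lookahead. -/
theorem Sound.responds_of_mem_homes {σ : WhiteStrategy} {n : ℕ}
    (he : ∀ k r, k ≠ r → Sound σ n k r home) {k r k' r' : Square} {t : ℕ} (ht : t ∈ homes)
    (hkr : k ≠ r) (hs : ∀ q ∈ squares t, Hidden k r q) (hm : Reaches k r k' r') :
    Responds (Escapes σ n) k' r' (squares t) := by
  have hne := hm.ne
  have hsound := he k' r' hne
  have h := of_allBelow (of_allBelow check_eq_true (code k') (code_lt k')) (code r') (code_lt r')
  rw [either_eq, Bool.or_eq_true, Nat.beq_eq, force_eq, allIn_eq] at h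
  have h' := List.all_eq_true.1 (h.resolve_left fun e => hne (code_injective e)) t ht
  rw [either_eq, Bool.or_eq_true, meets_eq_true, answers, either_eq, Bool.or_eq_true] at h'
  rcases h' with ⟨q, hq, hq'⟩ | h' | h'
  · rw [outlets, mem_squares_lor, mem_squares_prizes, mem_squares_around] at hq'
    rcases hq' with (hq' | hq') | ⟨p, hp, hpq⟩
    · exact Or.inl ⟨q, hq, hq'⟩
    · exact Or.inr (Or.inl ⟨q, hq, hq'⟩)
    · rw [mem_squares_remove, not_mem_squares_guarded hne] at hp
      refine Or.inr (Or.inr (Or.inl ⟨q, hq, Escapes.mono ?_ (hsound (bit (code p)) ?_ ?_)⟩))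
      · intro t ht
        rw [(mem_squares_bit p t).1 ht]
        exact ⟨hpq.symm, hp.2⟩
      · rw [home, either_eq, Bool.or_eq_true, meets_eq_true]
        exact Or.inl ⟨p, (mem_squares_bit p p).2 rfl, hp.1⟩
      · intro t ht
        rw [(mem_squares_bit p t).1 ht]
        exact hp.2
  · exact hsound.responds hne h'
  · have h := of_allMoves hne h' (hm.symm hkr)
    rw [either_eq, Bool.or_eq_true, meets_eq_true] at h
    rcases h with ⟨q, hq, hq'⟩ | h
    -- The home was hidden before the move, so this predecessor cannot be one that the check
    -- skipped.
    · exact absurd hq' ((not_mem_squares_guarded hkr q).2 (hs q hq))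
    -- Two nested expansions: up to two further rounds before a home is reached.
    · exact (hsound.expand hne fun k r hkr => (he k r hkr).expand hkr he).responds hne h

theorem sound_home (σ : WhiteStrategy) (n : ℕ) :
    ∀ k r, k ≠ r → Sound σ n k r home := by
  induction n with
  | zero =>
    intro k r _ s h _ l
    obtain ⟨t, ht, hts⟩ := exists_mem_homes h
    obtain ⟨q, hq⟩ := homes_nonempty t ht
    exact ⟨q, hts hq, trivial⟩
  | succ n ih =>
    intro k r hkr s h hs
    obtain ⟨t, ht, hts⟩ := exists_mem_homes h
    have ht' : ∀ q ∈ squares t, Hidden k r q := fun q hq => hs q (hts hq)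
    exact (Escapes.succ ht' fun k' r' hm => Sound.responds_of_mem_homes ih ht hkr ht' hm).mono hts

theorem mem_squares_centre {b : Square} (hfile : 2 ≤ b.1.val ∧ b.1.val ≤ 5)
    (hrank : 2 ≤ b.2.val ∧ b.2.val ≤ 5) : b ∈ squares centre := by
  have key : ∀ x y : Fin 8, 2 ≤ x.val ∧ x.val ≤ 5 → 2 ≤ y.val ∧ y.val ≤ 5 →
      centre.testBit (8 * x + y) = true := by decide +kernel
  exact key b.1 b.2 hfile hrank

end FogChess

theorem mainTheorem2 (k r b : FogChess.Square)
    (hkr : k ≠ r) (hkb : k ≠ b) (hrb : r ≠ b)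
    (hfile : 2 ≤ b.1.val ∧ b.1.val ≤ 5) (hrank : 2 ≤ b.2.val ∧ b.2.val ≤ 5)
    (hcheck : ¬ (FogChess.Position.mk k (some r) b).BlackInCheck)
    (σ : FogChess.WhiteStrategy) :
    ∃ τ : FogChess.BlackStrategy, ∀ n : ℕ,
      (FogChess.Game.after σ τ ⟨k, some r, b⟩ n).phase ≠ FogChess.Phase.whiteWon := by
  open FogChess in
  have hb : Hidden k r b :=
    ⟨hkb.symm, hrb.symm, fun h => hcheck (blackKing_mem_whiteVisible.2 h)⟩
  refine exists_blackStrategy σ fun n => ?_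
  have hhome : home (bit (code b)) = true := by
    rw [home, either_eq, Bool.or_eq_true, meets_eq_true]
    exact Or.inl ⟨b, (mem_squares_bit b b).2 rfl, mem_squares_centre hfile hrank⟩
  -- The set is the singleton of `b`, so the square chosen in hindsight is the true one.
  obtain ⟨q, hq, h⟩ := sound_home σ n k r hkr (bit (code b)) hhome
    (fun q hq => by rwa [(mem_squares_bit b q).1 hq]) []
  rwa [(mem_squares_bit b q).1 hq] at h
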